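/- Let $\mathbb X$ be a partially ordered Polish (POP) space, that is, a Polish space with a partial order $\preceq$ whose graph $\{(x,y): x\preceq y\}$ is closed in $\mathbb X^2$, equipped with its Borel $\sigma$-field, and let $I$ be a countable set. A family $\mathbf Y=(Y_i)_{i\in I}$ of random elements of $\mathbb X$ defined on a common probability space is called *negatively associated* (NA) if $$\mathbb E[f(Y_J)\,g(Y_{J^c})]\le \mathbb E[f(Y_J)]\,\mathbb E[g(Y_{J^c})]$$ for all $J\subset I$ and all bounded measurable functions $f:\mathbb X^J\to\mathbb R$, $g:\mathbb X^{J^c}\to\mathbb R$ that are non-decreasing for the coordinatewise order, and *positively associated* (PA) if $$\mathbb E[f(Y_J)\,g(Y_J)]\ge \mathbb E[f(Y_J)]\,\mathbb E[g(Y_J)]$$ for all $J\subset I$ and all bounded measurable functions $f,g:\mathbb X^J\to\mathbb R$ that are non-decreasing for the coordinatewise order; here $Y_J=(Y_i)_{i\in J}$ and $J^c=I\setminus J$. **Theorem.** Let $\mathbf X^k=(X^k_i)_{i\in I}$, $k\ge 1$, and $\mathbf X=(X_i)_{i\in I}$ be families of random elements of $\mathbb X$ (the families may be defined on different probability spaces)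 such that $\mathbf X^k$ converges in distribution to $\mathbf X$ as $k\to\infty$, as random elements of $\mathbb X^I$ with the product topology. If $\mathbf X^k$ is NA for every $k\ge1$, then $\mathbf X$ is NA; if $\mathbf X^k$ is PA for every $k\ge1$, then $\mathbf X$ is PA. -/

import Mathlib

open MeasureTheory Filter

/-- A family `X = (X i)_{i ∈ I}` of random elements of an ordered measurable space `E` is negatively
associated (NA) under `P` if `E[f(X_J) g(X_{Jᶜ})] ≤ E[f(X_J)] E[g(X_{Jᶜ})]` for every `J ⊆ I` and all
bounded measurable functions `f : E^J → ℝ` and `g : E^{Jᶜ} → ℝ` that are non-decreasing for the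
coordinatewise order. Here `X_J = (X i)_{i ∈ J}`. -/
def IsNegativelyAssociated {I Ω E : Type*} [MeasurableSpace Ω] [MeasurableSpace E] [PartialOrder E]
    (X : I → Ω → E) (P : Measure Ω) : Prop :=
  ∀ (J : Set I) (f : (J → E) → ℝ) (g : ((Jᶜ : Set I) → E) → ℝ),
    Measurable f → Monotone f → (∃ C : ℝ, ∀ x, |f x| ≤ C) →
    Measurable g → Monotone g → (∃ C : ℝ, ∀ x, |g x| ≤ C) →
    ∫ ω, f (fun j ↦ X j ω) * g (fun j ↦ X j ω) ∂P ≤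
      (∫ ω, f (fun j ↦ X j ω) ∂P) * ∫ ω, g (fun j ↦ X j ω) ∂P

/-- A family `X = (X i)_{i ∈ I}` of random elements of an ordered measurable space `E` is positively
associated (PA) under `P` if `E[f(X_J) g(X_J)] ≥ E[f(X_J)] E[g(X_J)]` for every `J ⊆ I` and all
bounded measurable functions `f, g : E^J → ℝ` that are non-decreasing for the coordinatewise
order. -/
def IsPositivelyAssociated {I Ω E : Type*} [MeasurableSpace Ω] [MeasurableSpace E] [PartialOrder E]
    (X : I → Ω → E) (P : Measure Ω) : Prop :=
  ∀ (J : Set I) (f g : (J → E) → ℝ),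
    Measurable f → Monotone f → (∃ C : ℝ, ∀ x, |f x| ≤ C) →
    Measurable g → Monotone g → (∃ C : ℝ, ∀ x, |g x| ≤ C) →
    (∫ ω, f (fun j ↦ X j ω) ∂P) * (∫ ω, g (fun j ↦ X j ω) ∂P) ≤
      ∫ ω, f (fun j ↦ X j ω) * g (fun j ↦ X j ω) ∂P

open Set Topology Metric

/-! ### Upper closures of compact sets -/

section UpperSets

variable {S : Type*} [TopologicalSpace S] [Preorder S] [OrderClosedTopology S]

/-! By layer cake, association need only be checked on measurable upper sets, where the test
functions are indicators. Such a set `A` need not be a continuity set of the limit law `μ`, so it is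
replaced by an open `O` and a closed upper `F`: `O` almost covers `A` under `μ`, `F` almost contains
`O` under every `μs k`, and `F` exceeds `A` only slightly under `μ`
(`exists_isOpen_isClosed_isUpperSet_approx`). The portmanteau theorem then passes from `μ` to `μs k`
on open sets and back on closed ones, while association of the prelimit is applied to the sets `F`,
so `O` need not be an upper set. -/

lemma IsCompact.isClosed_upperClosure {K : Set S} (hK : IsCompact K) :
    IsClosed (upperClosure K : Set S) := by
  have : CompactSpace K := isCompact_iff_compactSpace.mp hK
  have hcl : IsClosed {p : K × S | (p.1 : S) ≤ p.2} :=
    isClosed_le (continuous_subtype_val.comp continuous_fst) continuous_snd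
  -- The upper closure is the projection of the closed order graph over `K`, and projecting along a
  -- compact factor is a closed map.
  convert! isClosedMap_snd_of_compactSpace _ hcl using 1
  ext x
  simp [mem_upperClosure]

end UpperSets

/-! ### Tightness and approximation of upper sets -/

section Approximation

variable {S : Type*} [TopologicalSpace S] [PolishSpace S] [MeasurableSpace S] [BorelSpace S]

/-- A weakly convergent sequence of probability measures on a Polish space is uniformly tight. -/
lemma exists_isCompact_forall_measure_compl_le_of_tendsto {μs : ℕ → ProbabilityMeasure S}
    {μ : ProbabilityMeasure S} (h : Tendsto μs atTop (𝓝 μ)) {ε : ENNReal} (hε : 0 < ε) :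
    ∃ K : Set S, IsCompact K ∧ ∀ k, (μs k : Measure S) Kᶜ ≤ ε := by
  let := TopologicalSpace.upgradeIsCompletelyMetrizable S
  -- A convergent sequence together with its limit is compact, so the converse half of Prokhorov's
  -- theorem gives tightness.
  have hcomp : IsCompact (closure (range μs)) :=
    h.isCompact_insert_range.closure_of_subset (subset_insert _ _)
  obtain ⟨K, hK, hKle⟩ := isTightMeasureSet_iff_exists_isCompact_measure_compl_le.mp
    (isTightMeasureSet_of_isCompact_closure hcomp) ε hε
  exact ⟨K, hK, fun k ↦ hKle _ ⟨μs k, mem_range_self k, rfl⟩⟩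

variable [PartialOrder S] [OrderClosedTopology S]

/-- Along a weakly convergent sequence of probability measures on a partially ordered Polish space,
a measurable upper set can be approximated by an open set and a closed upper set. -/
lemma exists_isOpen_isClosed_isUpperSet_approx {μs : ℕ → ProbabilityMeasure S}
    {μ : ProbabilityMeasure S} (h : Tendsto μs atTop (𝓝 μ)) {A : Set S} (hA : MeasurableSet A)
    (hAu : IsUpperSet A) {ε : ℝ} (hε : 0 < ε) :
    ∃ O F : Set S, IsOpen O ∧ IsClosed F ∧ IsUpperSet F ∧ (μ : Measure S).real (A \ O) ≤ ε ∧
      (∀ k, (μs k : Measure S).real (O \ F) ≤ ε) ∧ (μ : Measure S).real (F \ A) ≤ ε := by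
  let := TopologicalSpace.upgradeIsCompletelyMetrizable S
  have hε' : 0 < ENNReal.ofReal ε := ENNReal.ofReal_pos.mpr hε
  obtain ⟨K₀, hK₀, hK₀le⟩ := exists_isCompact_forall_measure_compl_le_of_tendsto h hε'
  obtain ⟨K, hKA, hK, hKlt⟩ := hA.exists_isCompact_sdiff_lt (μ := (μ : Measure S))
    (measure_ne_top _ _) hε'.ne'
  obtain ⟨u, hu, hu0, hul⟩ := exists_seq_strictAnti_tendsto (0 : ℝ)
  have hC (n : ℕ) : IsCompact (cthickening (u n) K ∩ K₀) := hK₀.inter_left isClosed_cthickening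
  have hCanti : Antitone fun n ↦ cthickening (u n) K ∩ K₀ := fun m n hmn ↦
    inter_subset_inter_left _ (cthickening_mono (hu.antitone hmn) _)
  -- Intersecting with `K₀` makes the thickening compact, hence its upper closure closed.
  let U (n : ℕ) : Set S := upperClosure (cthickening (u n) K ∩ K₀)
  have hUanti : Antitone U := fun m n hmn ↦ upperClosure_anti (hCanti hmn)
  have hUcl (n : ℕ) : IsClosed (U n) := (hC n).isClosed_upperClosure
  -- If `x` lies in every `U n`, Cantor's intersection theorem gives one `y ≤ x` in all the
  -- thickenings, so `y ∈ K ⊆ A` and `x ∈ A`.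
  have hUA : ⋂ n, U n \ A = ∅ := by
    refine eq_empty_of_forall_notMem fun x hx ↦ ?_
    rw [mem_iInter] at hx
    obtain ⟨y, hy⟩ := IsCompact.nonempty_iInter_of_sequence_nonempty_isCompact_isClosed
      (fun n ↦ cthickening (u n) K ∩ K₀ ∩ Iic x)
      (fun n ↦ inter_subset_inter_left _ (hCanti n.le_succ))
      (fun n ↦ by
        obtain ⟨y, hy, hyx⟩ := mem_upperClosure.mp (hx n).1
        exact ⟨y, hy, hyx⟩)
      ((hC 0).inter_right isClosed_Iic) (fun n ↦ (hC n).isClosed.inter isClosed_Iic)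
    rw [mem_iInter] at hy
    have hyK : y ∈ K := by
      rw [← hK.isClosed.closure_eq, closure_eq_iInter_cthickening' K (range u)]
      · simpa using fun n ↦ (hy n).1.1
      · intro δ hδ
        obtain ⟨n, hn⟩ := (hul.eventually_lt_const hδ).exists
        exact ⟨u n, mem_range_self n, hu0 n, hn.le⟩
    exact (hx 0).2 (hAu (hy 0).2 (hKA hyK))
  have hlim : Tendsto (fun n ↦ (μ : Measure S) (U n \ A)) atTop (𝓝 0) := by
    have := tendsto_measure_iInter_atTop (μ := (μ : Measure S)) (s := fun n ↦ U n \ A)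
      (fun n ↦ ((hUcl n).measurableSet.diff hA).nullMeasurableSet)
      (fun m n hmn ↦ sdiff_subset_sdiff_left (hUanti hmn)) ⟨0, measure_ne_top _ _⟩
    simpa [hUA, Function.comp_def] using this
  obtain ⟨n, hn⟩ := (hlim.eventually_lt_const hε').exists
  refine ⟨thickening (u n) K, U n, isOpen_thickening, hUcl n, UpperSet.upper _,
    ENNReal.toReal_le_of_le_ofReal hε.le ?_, fun k ↦ ENNReal.toReal_le_of_le_ofReal hε.le ?_,
    ENNReal.toReal_le_of_le_ofReal hε.le hn.le⟩
  · exact (measure_mono (sdiff_subset_sdiff_right (self_subset_thickening (hu0 n) K))).trans hKlt.le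
  · refine (measure_mono fun x hx ↦ ?_).trans (hK₀le k)
    -- A point of the open thickening outside `U n` must lie outside `K₀`.
    exact fun hx₀ ↦ hx.2 (subset_upperClosure ⟨thickening_subset_cthickening _ _ hx.1, hx₀⟩)

end Approximation

/-! ### Portmanteau inequalities and small set differences -/

section Portmanteau

variable {Z : Type*} [TopologicalSpace Z] [MeasurableSpace Z] [OpensMeasurableSpace Z]
  [HasOuterApproxClosed Z] {ρs : ℕ → ProbabilityMeasure Z} {ρ : ProbabilityMeasure Z}

lemma MeasureTheory.ProbabilityMeasure.eventually_measureReal_le_add_of_isClosed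
    (h : Tendsto ρs atTop (𝓝 ρ)) {F : Set Z} (hF : IsClosed F) {ε : ℝ} (hε : 0 < ε) :
    ∀ᶠ k in atTop, (ρs k : Measure Z).real F ≤ (ρ : Measure Z).real F + ε := by
  have hlt : (ρ : Measure Z) F < (ρ : Measure Z) F + ENNReal.ofReal ε :=
    ENNReal.lt_add_right (measure_ne_top _ _) (ENNReal.ofReal_pos.mpr hε).ne'
  filter_upwards [eventually_lt_of_limsup_lt
    ((ProbabilityMeasure.limsup_measure_closed_le_of_tendsto h hF).trans_lt hlt)] with k hk
  have := ENNReal.toReal_mono (by finiteness) hk.le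
  rwa [ENNReal.toReal_add (by finiteness) (by finiteness), ENNReal.toReal_ofReal hε.le] at this

lemma MeasureTheory.ProbabilityMeasure.eventually_measureReal_le_add_of_isOpen
    (h : Tendsto ρs atTop (𝓝 ρ)) {O : Set Z} (hO : IsOpen O) {ε : ℝ} (hε : 0 < ε) :
    ∀ᶠ k in atTop, (ρ : Measure Z).real O ≤ (ρs k : Measure Z).real O + ε := by
  filter_upwards [eventually_measureReal_le_add_of_isClosed h hO.isClosed_compl hε] with k hk
  rw [probReal_compl_eq_one_sub hO.measurableSet, probReal_compl_eq_one_sub hO.measurableSet] at hk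
  linarith

end Portmanteau

lemma le_add_of_measureReal_sdiff_le {Z : Type*} [MeasurableSpace Z] (μ : Measure Z)
    [IsFiniteMeasure μ] {A B : Set Z} {ε : ℝ} (h : μ.real (A \ B) ≤ ε) :
    μ.real A ≤ μ.real B + ε := by
  have h₁ : μ.real A ≤ μ.real (B ∪ A \ B) := measureReal_mono (by rw [union_sdiff_self]; simp)
  have h₂ := measureReal_union_le (μ := μ) B (A \ B)
  linarith

lemma measureReal_inter_le_add {Z : Type*} [MeasurableSpace Z] (μ : Measure Z)
    [IsFiniteMeasure μ] {A A' B B' : Set Z} {ε : ℝ} (h : μ.real (A \ B) ≤ ε)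
    (h' : μ.real (A' \ B') ≤ ε) : μ.real (A ∩ A') ≤ μ.real (B ∩ B') + 2 * ε := by
  refine le_add_of_measureReal_sdiff_le μ ?_
  have h₁ : μ.real ((A ∩ A') \ (B ∩ B')) ≤ μ.real (A \ B ∪ A' \ B') :=
    measureReal_mono fun x hx ↦ by
      by_cases hxB : x ∈ B
      · exact Or.inr ⟨hx.1.2, fun hxB' ↦ hx.2 ⟨hxB, hxB'⟩⟩
      · exact Or.inl ⟨hx.1.1, hxB⟩
  have h₂ := measureReal_union_le (μ := μ) (A \ B) (A' \ B')
  linarith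

/-! ### Correlation inequalities for upper sets in the limit -/

section Limit

variable {Z S T : Type*} [TopologicalSpace Z] [MeasurableSpace Z] [BorelSpace Z]
  [TopologicalSpace S] [PolishSpace S] [MeasurableSpace S] [BorelSpace S]
  [PartialOrder S] [OrderClosedTopology S]
  [TopologicalSpace T] [PolishSpace T] [MeasurableSpace T] [BorelSpace T]
  [PartialOrder T] [OrderClosedTopology T]
  {ρs : ℕ → ProbabilityMeasure Z} {ρ : ProbabilityMeasure Z} {p : Z → S} {q : Z → T}

lemma exists_isOpen_isClosed_isUpperSet_preimage_approx (h : Tendsto ρs atTop (𝓝 ρ))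
    (hp : Continuous p) {A : Set S} (hA : MeasurableSet A) (hAu : IsUpperSet A) {ε : ℝ}
    (hε : 0 < ε) :
    ∃ O F : Set S, IsOpen O ∧ IsClosed F ∧ IsUpperSet F ∧
      (ρ : Measure Z).real (p ⁻¹' A \ p ⁻¹' O) ≤ ε ∧
      (∀ k, (ρs k : Measure Z).real (p ⁻¹' O \ p ⁻¹' F) ≤ ε) ∧
      (ρ : Measure Z).real (p ⁻¹' F \ p ⁻¹' A) ≤ ε := by
  obtain ⟨O, F, hO, hF, hFu, h₁, h₂, h₃⟩ := exists_isOpen_isClosed_isUpperSet_approx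
    (ProbabilityMeasure.tendsto_map_of_tendsto_of_continuous _ _ h hp) hA hAu hε
  have key (ν : ProbabilityMeasure Z) {B : Set S} (hB : MeasurableSet B) :
      (ν.map hp.measurable.aemeasurable : Measure S).real B = (ν : Measure Z).real (p ⁻¹' B) := by
    rw [ProbabilityMeasure.toMeasure_map, map_measureReal_apply hp.measurable hB]
  refine ⟨O, F, hO, hF, hFu, ?_, fun k ↦ ?_, ?_⟩
  · rwa [key _ (hA.diff hO.measurableSet)] at h₁
  · have := h₂ k
    rwa [key _ (hO.measurableSet.diff hF.measurableSet)] at this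
  · rwa [key _ (hF.measurableSet.diff hA)] at h₃

variable [PolishSpace Z]

/-- Negative correlation of upper sets passes to weak limits. -/
lemma measureReal_inter_le_mul_of_tendsto (h : Tendsto ρs atTop (𝓝 ρ)) (hp : Continuous p)
    (hq : Continuous q)
    (hρs : ∀ k (A : Set S) (B : Set T), MeasurableSet A → IsUpperSet A → MeasurableSet B →
      IsUpperSet B → (ρs k : Measure Z).real (p ⁻¹' A ∩ q ⁻¹' B) ≤
        (ρs k : Measure Z).real (p ⁻¹' A) * (ρs k : Measure Z).real (q ⁻¹' B))
    {A : Set S} {B : Set T} (hA : MeasurableSet A) (hAu : IsUpperSet A) (hB : MeasurableSet B)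
    (hBu : IsUpperSet B) :
    (ρ : Measure Z).real (p ⁻¹' A ∩ q ⁻¹' B) ≤
      (ρ : Measure Z).real (p ⁻¹' A) * (ρ : Measure Z).real (q ⁻¹' B) := by
  -- The `5 * ε`: two from `A, B` to `O, O'`, one from `ρ` to `ρs k`, two from `O, O'` to `F, F'`.
  have bound (ε : ℝ) (hε : 0 < ε) : (ρ : Measure Z).real (p ⁻¹' A ∩ q ⁻¹' B) ≤
      ((ρ : Measure Z).real (p ⁻¹' A) + 2 * ε) * ((ρ : Measure Z).real (q ⁻¹' B) + 2 * ε)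
        + 5 * ε := by
    obtain ⟨O, F, hO, hF, hFu, h₁, h₂, h₃⟩ :=
      exists_isOpen_isClosed_isUpperSet_preimage_approx h hp hA hAu hε
    obtain ⟨O', F', hO', hF', hFu', h₁', h₂', h₃'⟩ :=
      exists_isOpen_isClosed_isUpperSet_preimage_approx h hq hB hBu hε
    obtain ⟨k, hk, hk', hkO⟩ :=
      ((ProbabilityMeasure.eventually_measureReal_le_add_of_isClosed h (hF.preimage hp) hε).and
        ((ProbabilityMeasure.eventually_measureReal_le_add_of_isClosed h (hF'.preimage hq) hε).and
          (ProbabilityMeasure.eventually_measureReal_le_add_of_isOpen h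
            ((hO.preimage hp).inter (hO'.preimage hq)) hε))).exists
    have e₁ := measureReal_inter_le_add (ρ : Measure Z) h₁ h₁'
    have e₂ := measureReal_inter_le_add (ρs k : Measure Z) (h₂ k) (h₂' k)
    have e₃ := hρs k F F' hF.measurableSet hFu hF'.measurableSet hFu'
    have e₄ : (ρs k : Measure Z).real (p ⁻¹' F) ≤ (ρ : Measure Z).real (p ⁻¹' A) + 2 * ε := by
      linarith [le_add_of_measureReal_sdiff_le (ρ : Measure Z) h₃]
    have e₅ : (ρs k : Measure Z).real (q ⁻¹' F') ≤ (ρ : Measure Z).real (q ⁻¹' B) + 2 * ε := by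
      linarith [le_add_of_measureReal_sdiff_le (ρ : Measure Z) h₃']
    have e₆ := mul_le_mul e₄ e₅ measureReal_nonneg (measureReal_nonneg.trans e₄)
    linarith
  have hlim : Tendsto (fun ε : ℝ ↦ ((ρ : Measure Z).real (p ⁻¹' A) + 2 * ε) *
      ((ρ : Measure Z).real (q ⁻¹' B) + 2 * ε) + 5 * ε) (𝓝[>] 0)
      (𝓝 ((ρ : Measure Z).real (p ⁻¹' A) * (ρ : Measure Z).real (q ⁻¹' B))) := by
    refine tendsto_nhdsWithin_of_tendsto_nhds (Continuous.tendsto' (by fun_prop) _ _ (by simp))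
  exact ge_of_tendsto hlim (eventually_nhdsWithin_of_forall bound)

/-- Positive correlation of upper sets passes to weak limits. -/
lemma mul_le_measureReal_inter_of_tendsto (h : Tendsto ρs atTop (𝓝 ρ)) (hp : Continuous p)
    (hq : Continuous q)
    (hρs : ∀ k (A : Set S) (B : Set T), MeasurableSet A → IsUpperSet A → MeasurableSet B →
      IsUpperSet B → (ρs k : Measure Z).real (p ⁻¹' A) * (ρs k : Measure Z).real (q ⁻¹' B) ≤
        (ρs k : Measure Z).real (p ⁻¹' A ∩ q ⁻¹' B))
    {A : Set S} {B : Set T} (hA : MeasurableSet A) (hAu : IsUpperSet A) (hB : MeasurableSet B)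
    (hBu : IsUpperSet B) :
    (ρ : Measure Z).real (p ⁻¹' A) * (ρ : Measure Z).real (q ⁻¹' B) ≤
      (ρ : Measure Z).real (p ⁻¹' A ∩ q ⁻¹' B) := by
  -- Each factor loses `3 * ε` on the way to `F` or `F'`, costing `6 * ε + 9 * ε ^ 2` in the
  -- product; returning from `F ∩ F'` to `A ∩ B` costs `3 * ε`.
  have bound (ε : ℝ) (hε : 0 < ε) :
      (ρ : Measure Z).real (p ⁻¹' A) * (ρ : Measure Z).real (q ⁻¹' B) ≤
      (ρ : Measure Z).real (p ⁻¹' A ∩ q ⁻¹' B) + (9 * ε + 9 * ε ^ 2) := by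
    obtain ⟨O, F, hO, hF, hFu, h₁, h₂, h₃⟩ :=
      exists_isOpen_isClosed_isUpperSet_preimage_approx h hp hA hAu hε
    obtain ⟨O', F', hO', hF', hFu', h₁', h₂', h₃'⟩ :=
      exists_isOpen_isClosed_isUpperSet_preimage_approx h hq hB hBu hε
    obtain ⟨k, hk, hk', hkF⟩ :=
      ((ProbabilityMeasure.eventually_measureReal_le_add_of_isOpen h (hO.preimage hp) hε).and
        ((ProbabilityMeasure.eventually_measureReal_le_add_of_isOpen h (hO'.preimage hq) hε).and
          (ProbabilityMeasure.eventually_measureReal_le_add_of_isClosed h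
            ((hF.preimage hp).inter (hF'.preimage hq)) hε))).exists
    have e₁ := measureReal_inter_le_add (ρ : Measure Z) h₃ h₃'
    have e₃ := hρs k F F' hF.measurableSet hFu hF'.measurableSet hFu'
    have e₄ : (ρ : Measure Z).real (p ⁻¹' A) ≤ (ρs k : Measure Z).real (p ⁻¹' F) + 3 * ε := by
      linarith [le_add_of_measureReal_sdiff_le (ρ : Measure Z) h₁,
        le_add_of_measureReal_sdiff_le (ρs k : Measure Z) (h₂ k)]
    have e₅ : (ρ : Measure Z).real (q ⁻¹' B) ≤ (ρs k : Measure Z).real (q ⁻¹' F') + 3 * ε := by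
      linarith [le_add_of_measureReal_sdiff_le (ρ : Measure Z) h₁',
        le_add_of_measureReal_sdiff_le (ρs k : Measure Z) (h₂' k)]
    have e₆ := mul_le_mul e₄ e₅ measureReal_nonneg (measureReal_nonneg.trans e₄)
    have e₇ : (ρs k : Measure Z).real (p ⁻¹' F) * ε ≤ 1 * ε :=
      mul_le_mul_of_nonneg_right measureReal_le_one hε.le
    have e₈ : (ρs k : Measure Z).real (q ⁻¹' F') * ε ≤ 1 * ε :=
      mul_le_mul_of_nonneg_right measureReal_le_one hε.le
    linarith
  have hlim : Tendsto (fun ε : ℝ ↦ (ρ : Measure Z).real (p ⁻¹' A ∩ q ⁻¹' B) +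
      (9 * ε + 9 * ε ^ 2)) (𝓝[>] 0) (𝓝 ((ρ : Measure Z).real (p ⁻¹' A ∩ q ⁻¹' B))) :=
    tendsto_nhdsWithin_of_tendsto_nhds (Continuous.tendsto' (by fun_prop) _ _ (by simp))
  exact ge_of_tendsto hlim (eventually_nhdsWithin_of_forall bound)

end Limit

/-! ### From superlevel sets to bounded functions -/

section LayerCake

variable {Ω : Type*} [MeasurableSpace Ω]

lemma lintegral_ofReal_mono_of_measure_lt_le {μ ν : Measure Ω} {F : Ω → ℝ} (hF : Measurable F)
    (hF0 : 0 ≤ F) (h : ∀ t, μ {ω | t < F ω} ≤ ν {ω | t < F ω}) :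
    ∫⁻ ω, ENNReal.ofReal (F ω) ∂μ ≤ ∫⁻ ω, ENNReal.ofReal (F ω) ∂ν := by
  rw [lintegral_eq_lintegral_meas_lt μ (ae_of_all _ hF0) hF.aemeasurable,
    lintegral_eq_lintegral_meas_lt ν (ae_of_all _ hF0) hF.aemeasurable]
  exact lintegral_mono h

variable {P : Measure Ω} {F G : Ω → ℝ}

/-- Layer cake, one variable at a time: first `G` is integrated against `P` restricted to `{s < F}`,
then `F` against the measure with density `G`. This avoids a double integral over levels. -/
lemma lintegral_mul_le_of_measure_inter_le (hF : Measurable F) (hG : Measurable G) (hF0 : 0 ≤ F)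
    (hG0 : 0 ≤ G)
    (h : ∀ s t, P ({ω | s < F ω} ∩ {ω | t < G ω}) ≤ P {ω | s < F ω} * P {ω | t < G ω}) :
    ∫⁻ ω, ENNReal.ofReal (F ω) * ENNReal.ofReal (G ω) ∂P ≤
      (∫⁻ ω, ENNReal.ofReal (F ω) ∂P) * ∫⁻ ω, ENNReal.ofReal (G ω) ∂P := by
  have hFs (s : ℝ) : MeasurableSet {ω | s < F ω} := measurableSet_lt measurable_const hF
  have hGs (s : ℝ) : MeasurableSet {ω | s < G ω} := measurableSet_lt measurable_const hG
  have h₁ (s : ℝ) : ∫⁻ ω in {ω | s < F ω}, ENNReal.ofReal (G ω) ∂P ≤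
      P {ω | s < F ω} * ∫⁻ ω, ENNReal.ofReal (G ω) ∂P := by
    rw [← smul_eq_mul, ← lintegral_smul_measure]
    refine lintegral_ofReal_mono_of_measure_lt_le hG hG0 fun t ↦ ?_
    rw [Measure.restrict_apply (hGs t), inter_comm, Measure.smul_apply, smul_eq_mul]
    exact h s t
  have h₂ : ∫⁻ ω, ENNReal.ofReal (F ω) ∂(P.withDensity fun ω ↦ ENNReal.ofReal (G ω)) ≤
      ∫⁻ ω, ENNReal.ofReal (F ω) ∂((∫⁻ ω, ENNReal.ofReal (G ω) ∂P) • P) := by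
    refine lintegral_ofReal_mono_of_measure_lt_le hF hF0 fun s ↦ ?_
    rw [withDensity_apply _ (hFs s), Measure.smul_apply, smul_eq_mul, mul_comm]
    exact h₁ s
  rw [lintegral_smul_measure, smul_eq_mul,
    lintegral_withDensity_eq_lintegral_mul _ hG.ennreal_ofReal hF.ennreal_ofReal] at h₂
  simpa [mul_comm] using h₂

lemma mul_lintegral_le_of_measure_inter_ge (hF : Measurable F) (hG : Measurable G) (hF0 : 0 ≤ F)
    (hG0 : 0 ≤ G)
    (h : ∀ s t, P {ω | s < F ω} * P {ω | t < G ω} ≤ P ({ω | s < F ω} ∩ {ω | t < G ω})) :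
    (∫⁻ ω, ENNReal.ofReal (F ω) ∂P) * ∫⁻ ω, ENNReal.ofReal (G ω) ∂P ≤
      ∫⁻ ω, ENNReal.ofReal (F ω) * ENNReal.ofReal (G ω) ∂P := by
  have hFs (s : ℝ) : MeasurableSet {ω | s < F ω} := measurableSet_lt measurable_const hF
  have hGs (s : ℝ) : MeasurableSet {ω | s < G ω} := measurableSet_lt measurable_const hG
  have h₁ (s : ℝ) : P {ω | s < F ω} * ∫⁻ ω, ENNReal.ofReal (G ω) ∂P ≤
      ∫⁻ ω in {ω | s < F ω}, ENNReal.ofReal (G ω) ∂P := by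
    rw [← smul_eq_mul, ← lintegral_smul_measure]
    refine lintegral_ofReal_mono_of_measure_lt_le hG hG0 fun t ↦ ?_
    rw [Measure.restrict_apply (hGs t), inter_comm, Measure.smul_apply, smul_eq_mul]
    exact h s t
  have h₂ : ∫⁻ ω, ENNReal.ofReal (F ω) ∂((∫⁻ ω, ENNReal.ofReal (G ω) ∂P) • P) ≤
      ∫⁻ ω, ENNReal.ofReal (F ω) ∂(P.withDensity fun ω ↦ ENNReal.ofReal (G ω)) := by
    refine lintegral_ofReal_mono_of_measure_lt_le hF hF0 fun s ↦ ?_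
    rw [withDensity_apply _ (hFs s), Measure.smul_apply, smul_eq_mul, mul_comm]
    exact h₁ s
  rw [lintegral_smul_measure, smul_eq_mul,
    lintegral_withDensity_eq_lintegral_mul _ hG.ennreal_ofReal hF.ennreal_ofReal] at h₂
  simpa [mul_comm] using h₂

lemma toReal_lintegral_ofReal_mul (hF : Measurable F) (hG : Measurable G) (hF0 : 0 ≤ F)
    (hG0 : 0 ≤ G) :
    (∫⁻ ω, ENNReal.ofReal (F ω) * ENNReal.ofReal (G ω) ∂P).toReal = ∫ ω, F ω * G ω ∂P := by
  rw [integral_eq_lintegral_of_nonneg_ae (ae_of_all _ fun ω ↦ mul_nonneg (hF0 ω) (hG0 ω))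
    (hF.mul hG).aestronglyMeasurable]
  simp_rw [fun ω ↦ ENNReal.ofReal_mul (q := G ω) (hF0 ω)]

lemma toReal_lintegral_mul_lintegral (hF : Measurable F) (hG : Measurable G) (hF0 : 0 ≤ F)
    (hG0 : 0 ≤ G) :
    ((∫⁻ ω, ENNReal.ofReal (F ω) ∂P) * ∫⁻ ω, ENNReal.ofReal (G ω) ∂P).toReal =
      (∫ ω, F ω ∂P) * ∫ ω, G ω ∂P := by
  rw [ENNReal.toReal_mul,
    integral_eq_lintegral_of_nonneg_ae (ae_of_all _ hF0) hF.aestronglyMeasurable,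
    integral_eq_lintegral_of_nonneg_ae (ae_of_all _ hG0) hG.aestronglyMeasurable]

variable [IsProbabilityMeasure P]

lemma integrable_of_forall_abs_le (hF : Measurable F) {C : ℝ} (hC : ∀ ω, |F ω| ≤ C) :
    Integrable F P :=
  Integrable.of_bound hF.aestronglyMeasurable C (ae_of_all _ hC)

/-- Covariance ignores constant shifts, so bounded functions may be taken nonnegative. -/
lemma integral_add_const_mul_add_const (hF : Measurable F) (hG : Measurable G) {C D : ℝ}
    (hC : ∀ ω, |F ω| ≤ C) (hD : ∀ ω, |G ω| ≤ D) (a b : ℝ) :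
    ∫ ω, (F ω + a) * (G ω + b) ∂P - (∫ ω, F ω + a ∂P) * ∫ ω, G ω + b ∂P =
      ∫ ω, F ω * G ω ∂P - (∫ ω, F ω ∂P) * ∫ ω, G ω ∂P := by
  have iF : Integrable F P := integrable_of_forall_abs_le hF hC
  have iG : Integrable G P := integrable_of_forall_abs_le hG hD
  have iFG : Integrable (fun ω ↦ F ω * G ω) P :=
    integrable_of_forall_abs_le (hF.mul hG) (C := C * D) fun ω ↦ by
      rw [abs_mul]
      exact mul_le_mul (hC ω) (hD ω) (abs_nonneg _) ((abs_nonneg _).trans (hC ω))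
  have hexp : ∀ ω, (F ω + a) * (G ω + b) = F ω * G ω + (F ω * b + (a * G ω + a * b)) :=
    fun ω ↦ by ring
  simp_rw [hexp]
  rw [integral_add iFG (by fun_prop), integral_add (by fun_prop) (by fun_prop),
    integral_add (by fun_prop) (by fun_prop), integral_add iF (by fun_prop),
    integral_add iG (by fun_prop), integral_mul_const, integral_const_mul]
  simp
  ring

lemma lintegral_ofReal_ne_top (hF : Measurable F) {C : ℝ} (hC : ∀ ω, |F ω| ≤ C) :
    ∫⁻ ω, ENNReal.ofReal (F ω) ∂P ≠ ⊤ :=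
  (integrable_of_forall_abs_le hF hC).lintegral_lt_top.ne

/-- Bounded random variables with negatively correlated superlevel sets are negatively
correlated. -/
lemma integral_mul_le_of_measureReal_inter_le (hF : Measurable F) (hG : Measurable G) {C D : ℝ}
    (hC : ∀ ω, |F ω| ≤ C) (hD : ∀ ω, |G ω| ≤ D)
    (h : ∀ s t, P.real ({ω | s < F ω} ∩ {ω | t < G ω}) ≤
      P.real {ω | s < F ω} * P.real {ω | t < G ω}) :
    ∫ ω, F ω * G ω ∂P ≤ (∫ ω, F ω ∂P) * ∫ ω, G ω ∂P := by
  rw [← sub_nonpos, ← integral_add_const_mul_add_const hF hG hC hD C D, sub_nonpos]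
  have hF0 : 0 ≤ fun ω ↦ F ω + C := fun ω ↦ by
    have := (abs_le.mp (hC ω)).1
    simp only [Pi.zero_apply]
    linarith
  have hG0 : 0 ≤ fun ω ↦ G ω + D := fun ω ↦ by
    have := (abs_le.mp (hD ω)).1
    simp only [Pi.zero_apply]
    linarith
  have hF' : Measurable fun ω ↦ F ω + C := hF.add_const C
  have hG' : Measurable fun ω ↦ G ω + D := hG.add_const D
  rw [← toReal_lintegral_ofReal_mul hF' hG' hF0 hG0,
    ← toReal_lintegral_mul_lintegral hF' hG' hF0 hG0]
  refine ENNReal.toReal_mono (ENNReal.mul_ne_top (lintegral_ofReal_ne_top hF' (C := 2 * C) ?_)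
    (lintegral_ofReal_ne_top hG' (C := 2 * D) ?_))
    (lintegral_mul_le_of_measure_inter_le hF' hG' hF0 hG0 fun s t ↦ ?_)
  · exact fun ω ↦ (abs_of_nonneg (hF0 ω)).trans_le (by linarith [(abs_le.mp (hC ω)).2])
  · exact fun ω ↦ (abs_of_nonneg (hG0 ω)).trans_le (by linarith [(abs_le.mp (hD ω)).2])
  -- Shifting the functions only relabels their superlevel sets.
  · simp_rw [← sub_lt_iff_lt_add]
    rw [← ENNReal.toReal_le_toReal (by finiteness) (by finiteness), ENNReal.toReal_mul]
    exact h _ _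

/-- Bounded random variables with positively correlated superlevel sets are positively
correlated. -/
lemma mul_integral_le_of_measureReal_inter_ge (hF : Measurable F) (hG : Measurable G) {C D : ℝ}
    (hC : ∀ ω, |F ω| ≤ C) (hD : ∀ ω, |G ω| ≤ D)
    (h : ∀ s t, P.real {ω | s < F ω} * P.real {ω | t < G ω} ≤
      P.real ({ω | s < F ω} ∩ {ω | t < G ω})) :
    (∫ ω, F ω ∂P) * ∫ ω, G ω ∂P ≤ ∫ ω, F ω * G ω ∂P := by
  rw [← sub_nonneg, ← integral_add_const_mul_add_const hF hG hC hD C D, sub_nonneg]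
  have hF0 : 0 ≤ fun ω ↦ F ω + C := fun ω ↦ by
    have := (abs_le.mp (hC ω)).1
    simp only [Pi.zero_apply]
    linarith
  have hG0 : 0 ≤ fun ω ↦ G ω + D := fun ω ↦ by
    have := (abs_le.mp (hD ω)).1
    simp only [Pi.zero_apply]
    linarith
  have hF' : Measurable fun ω ↦ F ω + C := hF.add_const C
  have hG' : Measurable fun ω ↦ G ω + D := hG.add_const D
  have hFle (ω : Ω) : |F ω + C| ≤ 2 * C :=
    (abs_of_nonneg (hF0 ω)).trans_le (by linarith [(abs_le.mp (hC ω)).2])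
  have hGle (ω : Ω) : |G ω + D| ≤ 2 * D :=
    (abs_of_nonneg (hG0 ω)).trans_le (by linarith [(abs_le.mp (hD ω)).2])
  rw [← toReal_lintegral_ofReal_mul hF' hG' hF0 hG0,
    ← toReal_lintegral_mul_lintegral hF' hG' hF0 hG0]
  refine ENNReal.toReal_mono ?_
    (mul_lintegral_le_of_measure_inter_ge hF' hG' hF0 hG0 fun s t ↦ ?_)
  · simp_rw [← fun ω ↦ ENNReal.ofReal_mul (q := G ω + D) (hF0 ω)]
    refine lintegral_ofReal_ne_top (hF'.mul hG') (C := 2 * C * (2 * D)) fun ω ↦ ?_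
    rw [abs_mul]
    exact mul_le_mul (hFle ω) (hGle ω) (abs_nonneg _) ((abs_nonneg _).trans (hFle ω))
  · simp_rw [← sub_lt_iff_lt_add]
    rw [← ENNReal.toReal_le_toReal (by finiteness) (by finiteness), ENNReal.toReal_mul]
    exact h _ _

end LayerCake

/-! ### Indicators of upper sets as test functions -/

section Indicator

lemma IsUpperSet.monotone_indicator_one {S : Type*} [Preorder S] {A : Set S} (hA : IsUpperSet A) :
    Monotone (A.indicator (1 : S → ℝ)) := fun x y hxy ↦ by
  by_cases hx : x ∈ A
  · rw [indicator_of_mem hx, indicator_of_mem (hA hxy hx)]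
    exact le_rfl
  · rw [indicator_of_notMem hx]
    exact indicator_nonneg (fun _ _ ↦ zero_le_one) y

lemma abs_indicator_one_le {S : Type*} (A : Set S) (x : S) : |A.indicator (1 : S → ℝ) x| ≤ 1 := by
  by_cases hx : x ∈ A <;> simp [hx]

lemma integral_indicator_one_comp {Ω S : Type*} [MeasurableSpace Ω] [MeasurableSpace S]
    (P : Measure Ω) {Y : Ω → S} (hY : Measurable Y) {A : Set S} (hA : MeasurableSet A) :
    ∫ ω, A.indicator (1 : S → ℝ) (Y ω) ∂P = P.real (Y ⁻¹' A) :=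
  integral_indicator_one (hY hA)

lemma integral_indicator_one_mul_comp {Ω S T : Type*} [MeasurableSpace Ω] [MeasurableSpace S]
    [MeasurableSpace T] (P : Measure Ω) {Y : Ω → S} (hY : Measurable Y) {Y' : Ω → T}
    (hY' : Measurable Y') {A : Set S} (hA : MeasurableSet A) {B : Set T} (hB : MeasurableSet B) :
    ∫ ω, A.indicator (1 : S → ℝ) (Y ω) * B.indicator (1 : T → ℝ) (Y' ω) ∂P =
      P.real (Y ⁻¹' A ∩ Y' ⁻¹' B) := by
  rw [← integral_indicator_one ((hY hA).inter (hY' hB))]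
  congr 1 with ω
  by_cases h₁ : Y ω ∈ A <;> by_cases h₂ : Y' ω ∈ B <;> simp [h₁, h₂]

end Indicator

theorem theorem3p6 {E : Type*} [TopologicalSpace E] [PolishSpace E] [PartialOrder E]
    [OrderClosedTopology E] [MeasurableSpace E] [BorelSpace E]
    {I : Type*} [Countable I]
    {Ω : ℕ → Type*} [∀ k, MeasurableSpace (Ω k)]
    (P : (k : ℕ) → Measure (Ω k)) [∀ k, IsProbabilityMeasure (P k)]
    {Ω' : Type*} [MeasurableSpace Ω'] (P' : Measure Ω') [IsProbabilityMeasure P']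
    (Xk : (k : ℕ) → I → Ω k → E) (X : I → Ω' → E)
    (hXk : ∀ k i, Measurable (Xk k i)) (hX : ∀ i, Measurable (X i))
    (hconv : TendstoInDistribution (fun (k : ℕ) (ω : Ω k) (i : I) ↦ Xk k i ω) atTop
      (fun (ω : Ω') (i : I) ↦ X i ω) P P') :
    ((∀ k, IsNegativelyAssociated (Xk k) (P k)) → IsNegativelyAssociated X P') ∧
      ((∀ k, IsPositivelyAssociated (Xk k) (P k)) → IsPositivelyAssociated X P') := by
  have hXm : Measurable fun (ω : Ω') (i : I) ↦ X i ω := measurable_pi_lambda _ hX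
  have hXkm (k : ℕ) : Measurable fun (ω : Ω k) (i : I) ↦ Xk k i ω := measurable_pi_lambda _ (hXk k)
  have hres (J : Set I) : Continuous (J.domRestrict : (I → E) → J → E) := Pi.continuous_domRestrict J
  have hXkJ (k : ℕ) (J : Set I) : Measurable fun (ω : Ω k) (j : J) ↦ Xk k j ω :=
    (hres J).measurable.comp (hXkm k)
  have hlim := hconv.tendsto
  constructor
  · intro hNA J f g hf hfm ⟨C, hC⟩ hg hgm ⟨D, hD⟩
    refine integral_mul_le_of_measureReal_inter_le (C := C) (D := D)
      (hf.comp ((hres J).measurable.comp hXm)) (hg.comp ((hres Jᶜ).measurable.comp hXm))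
      (fun ω ↦ hC _) (fun ω ↦ hD _) fun s t ↦ ?_
    have hfs : MeasurableSet (f ⁻¹' Ioi s) := hf measurableSet_Ioi
    have hgt : MeasurableSet (g ⁻¹' Ioi t) := hg measurableSet_Ioi
    have key := measureReal_inter_le_mul_of_tendsto hlim (hres J) (hres Jᶜ) ?_ hfs
      ((isUpperSet_Ioi s).preimage hfm) hgt ((isUpperSet_Ioi t).preimage hgm)
    · simp only [ProbabilityMeasure.coe_mk] at key
      rwa [map_measureReal_apply hXm ((hres J).measurable hfs),
        map_measureReal_apply hXm ((hres Jᶜ).measurable hgt),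
        map_measureReal_apply hXm (((hres J).measurable hfs).inter ((hres Jᶜ).measurable hgt))]
        at key
    · intro k A B hA hAu hB hBu
      have := hNA k J (A.indicator 1) (B.indicator 1) (measurable_one.indicator hA)
        hAu.monotone_indicator_one ⟨1, abs_indicator_one_le A⟩ (measurable_one.indicator hB)
        hBu.monotone_indicator_one ⟨1, abs_indicator_one_le B⟩
      simp only [ProbabilityMeasure.coe_mk]
      rw [map_measureReal_apply (hXkm k) ((hres J).measurable hA),
        map_measureReal_apply (hXkm k) ((hres Jᶜ).measurable hB),
        map_measureReal_apply (hXkm k) (((hres J).measurable hA).inter ((hres Jᶜ).measurable hB))]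
      rwa [integral_indicator_one_mul_comp _ (hXkJ k J) (hXkJ k Jᶜ) hA hB,
        integral_indicator_one_comp _ (hXkJ k J) hA,
        integral_indicator_one_comp _ (hXkJ k Jᶜ) hB] at this
  · intro hPA J f g hf hfm ⟨C, hC⟩ hg hgm ⟨D, hD⟩
    refine mul_integral_le_of_measureReal_inter_ge (C := C) (D := D)
      (hf.comp ((hres J).measurable.comp hXm)) (hg.comp ((hres J).measurable.comp hXm))
      (fun ω ↦ hC _) (fun ω ↦ hD _) fun s t ↦ ?_
    have hfs : MeasurableSet (f ⁻¹' Ioi s) := hf measurableSet_Ioi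
    have hgt : MeasurableSet (g ⁻¹' Ioi t) := hg measurableSet_Ioi
    have key := mul_le_measureReal_inter_of_tendsto hlim (hres J) (hres J) ?_ hfs
      ((isUpperSet_Ioi s).preimage hfm) hgt ((isUpperSet_Ioi t).preimage hgm)
    · simp only [ProbabilityMeasure.coe_mk] at key
      rwa [map_measureReal_apply hXm ((hres J).measurable hfs),
        map_measureReal_apply hXm ((hres J).measurable hgt),
        map_measureReal_apply hXm (((hres J).measurable hfs).inter ((hres J).measurable hgt))]
        at key
    · intro k A B hA hAu hB hBu
      have := hPA k J (A.indicator 1) (B.indicator 1) (measurable_one.indicator hA)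
        hAu.monotone_indicator_one ⟨1, abs_indicator_one_le A⟩ (measurable_one.indicator hB)
        hBu.monotone_indicator_one ⟨1, abs_indicator_one_le B⟩
      simp only [ProbabilityMeasure.coe_mk]
      rw [map_measureReal_apply (hXkm k) ((hres J).measurable hA),
        map_measureReal_apply (hXkm k) ((hres J).measurable hB),
        map_measureReal_apply (hXkm k) (((hres J).measurable hA).inter ((hres J).measurable hB))]
      rwa [integral_indicator_one_mul_comp _ (hXkJ k J) (hXkJ k J) hA hB,
        integral_indicator_one_comp _ (hXkJ k J) hA,
        integral_indicator_one_comp _ (hXkJ k J) hB] at this
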